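/- Let $\Omega=(a,b)\subset\mathbb{R}$ be a bounded open interval ($a<b$), let $f\in \mathrm{BV}(\Omega)$, and let $\alpha\in C(\overline{\Omega})$ with $\alpha>0$ on $\overline\Omega=[a,b]$. For $w\in\mathrm{BV}(\Omega)$ let $Dw$ denote its distributional derivative (a finite signed Radon measure on $\Omega$), $|Dw|$ the total variation measure of $Dw$, and $J_w=\{x\in\Omega:\ |Dw|(\{x\})\neq 0\}$ its jump set. Let $u\in \mathrm{BV}(\Omega)$ be a solution of the weighted total variation problem $$\min_{w\in \mathrm{BV}(\Omega)}\ \frac12\int_\Omega (f-w)^2\,dx+\int_\Omega \alpha(x)\,d|Dw| .$$ If $x\in\Omega$ is a point at which $\alpha$ is differentiable and $|Df|(\{x\})=0$, i.e. $x\notin J_f$, then $x\notin J_u$. Consequently, $$J_u\setminus J_f\subseteq\{x\in\Omega:\ \alpha \text{ is not differentiable at } x\}.$$ -/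

import Mathlib

open MeasureTheory Set

open scoped ContDiff

namespace WeightedTV

noncomputable section

/-- The integral `∫ φ dμ` against a finite signed measure `μ` on the real line, through the Jordan
decomposition `μ = μ⁺ - μ⁻`. -/
def signedIntegral (μ : SignedMeasure ℝ) (φ : ℝ → ℝ) : ℝ :=
  (∫ t, φ t ∂μ.toJordanDecomposition.posPart) - ∫ t, φ t ∂μ.toJordanDecomposition.negPart

/-- `φ` is a test function on the open interval `Ω = (a, b)`: smooth, with compact support
contained in `Ω`. -/
structure IsTestFunction (a b : ℝ) (φ : ℝ → ℝ) : Prop where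
  contDiff : ContDiff ℝ ∞ φ
  hasCompactSupport : HasCompactSupport φ
  tsupport_subset : tsupport φ ⊆ Ioo a b

/-- The finite signed measure `μ` on `Ω = (a, b)` (regarded as a signed measure on the line that
does not charge the complement of `Ω`) represents the distributional derivative of `u` on `Ω`:
`∫_Ω u φ' dt = - ∫_Ω φ dμ` for every test function `φ`. -/
structure IsDistribDeriv (a b : ℝ) (u : ℝ → ℝ) (μ : SignedMeasure ℝ) : Prop where
  concentrated : μ.totalVariation (Ioo a b)ᶜ = 0
  integral_deriv : ∀ φ : ℝ → ℝ, IsTestFunction a b φ →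
    ∫ t in Ioo a b, u t * deriv φ t = -signedIntegral μ φ

/-- `u ∈ BV(Ω)` for `Ω = (a, b)`: `u` is in `L¹(Ω)` and its distributional derivative on `Ω` is a
finite signed measure. Only the values of `u` in `Ω` matter, and only up to a null set. -/
def IsBV (a b : ℝ) (u : ℝ → ℝ) : Prop :=
  IntegrableOn u (Ioo a b) ∧ ∃ μ : SignedMeasure ℝ, IsDistribDeriv a b u μ

open Classical in
/-- The measure `Du` of `u ∈ BV(Ω)`; it is unique, see `IsBV.distribDeriv_eq`.
(It is `0` when `u` is not in `BV(Ω)`, a case that is never used.) -/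
def distribDeriv (a b : ℝ) (u : ℝ → ℝ) : SignedMeasure ℝ :=
  if h : IsBV a b u then h.2.choose else 0

/-- The total variation measure `|Du|`. -/
def derivVariation (a b : ℝ) (u : ℝ → ℝ) : Measure ℝ :=
  (distribDeriv a b u).totalVariation

/-- The jump set `J_u = {x ∈ Ω : |Du|({x}) ≠ 0}`. -/
def jumpSet (a b : ℝ) (u : ℝ → ℝ) : Set ℝ :=
  {x | x ∈ Ioo a b ∧ derivVariation a b u {x} ≠ 0}

/-- The weighted total variation functional
`½ ∫_Ω (f - u)² dt + ∫_Ω α d|Du|`. For `f, u ∈ BV(Ω)` and `α` continuous on `[a, b]` both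
integrands are integrable, since functions of bounded variation of one variable are essentially
bounded and `|Du|` is finite. -/
def energy (a b : ℝ) (α f u : ℝ → ℝ) : ℝ :=
  (1 / 2) * (∫ t in Ioo a b, (f t - u t) ^ 2) + ∫ t in Ioo a b, α t ∂(derivVariation a b u)

/-- `u ∈ BV(Ω)` minimises the weighted total variation functional over `BV(Ω)`. -/
def IsSolution (a b : ℝ) (α f u : ℝ → ℝ) : Prop :=
  IsBV a b u ∧ ∀ w : ℝ → ℝ, IsBV a b w → energy a b α f u ≤ energy a b α f w

theorem IsBV.isDistribDeriv {a b : ℝ} {u : ℝ → ℝ} (h : IsBV a b u) :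
    IsDistribDeriv a b u (distribDeriv a b u) := by
  unfold distribDeriv
  rw [dif_pos h]
  exact h.2.choose_spec

/-- The distributional derivative is unique. -/
theorem IsDistribDeriv.unique {a b : ℝ} {u : ℝ → ℝ} {μ ν : SignedMeasure ℝ}
    (hμ : IsDistribDeriv a b u μ) (hν : IsDistribDeriv a b u ν) : μ = ν := by
  set p := μ.toJordanDecomposition.posPart with hp
  set n := μ.toJordanDecomposition.negPart with hn
  set p' := ν.toJordanDecomposition.posPart with hp'
  set n' := ν.toJordanDecomposition.negPart with hn'
  have : IsFiniteMeasure p := μ.toJordanDecomposition.posPart_finite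
  have : IsFiniteMeasure n := μ.toJordanDecomposition.negPart_finite
  have : IsFiniteMeasure p' := ν.toJordanDecomposition.posPart_finite
  have : IsFiniteMeasure n' := ν.toJordanDecomposition.negPart_finite
  set m1 := p + n' with hm1
  set m2 := p' + n with hm2
  have : IsFiniteMeasure m1 := by rw [hm1]; infer_instance
  have : IsFiniteMeasure m2 := by rw [hm2]; infer_instance
  set l := m1 + m2 with hl
  have : IsFiniteMeasure l := by rw [hl]; infer_instance
  have : m1.HaveLebesgueDecomposition l := Measure.haveLebesgueDecomposition_of_sigmaFinite m1 l
  have : m2.HaveLebesgueDecomposition l := Measure.haveLebesgueDecomposition_of_sigmaFinite m2 l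
  have h1 : m1 ≪ l := (Measure.le_add_right le_rfl).absolutelyContinuous
  have h2 : m2 ≪ l := (Measure.le_add_left le_rfl).absolutelyContinuous
  have e1 : ∀ g : ℝ → ℝ, ∫ t, (m1.rnDeriv l t).toReal • g t ∂l = ∫ t, g t ∂m1 :=
    fun g => integral_rnDeriv_smul h1
  have e2 : ∀ g : ℝ → ℝ, ∫ t, (m2.rnDeriv l t).toReal • g t ∂l = ∫ t, g t ∂m2 :=
    fun g => integral_rnDeriv_smul h2
  have i1 : Integrable (fun t => (m1.rnDeriv l t).toReal) l := Measure.integrable_toReal_rnDeriv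
  have i2 : Integrable (fun t => (m2.rnDeriv l t).toReal) l := Measure.integrable_toReal_rnDeriv
  have cμ := hμ.concentrated
  have cν := hν.concentrated
  simp only [SignedMeasure.totalVariation, Measure.coe_add, Pi.add_apply, add_eq_zero] at cμ cν
  have key : ∀ᵐ t ∂l, t ∈ Ioo a b → (m1.rnDeriv l t).toReal - (m2.rnDeriv l t).toReal = 0 := by
    refine isOpen_Ioo.ae_eq_zero_of_integral_contDiff_smul_eq_zero
      ((i1.sub i2).locallyIntegrable.locallyIntegrableOn _) ?_
    intro g hg hc hs
    have hI : ∀ m : Measure ℝ, ∀ [IsFiniteMeasure m], Integrable g m := fun m _ =>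
      hg.continuous.integrable_of_hasCompactSupport hc
    have t1 := hμ.integral_deriv g ⟨hg, hc, hs⟩
    have t2 := hν.integral_deriv g ⟨hg, hc, hs⟩
    have t3 : ∫ t, g t ∂m1 = ∫ t, g t ∂m2 := by
      rw [hm1, hm2, integral_add_measure (hI _) (hI _), integral_add_measure (hI _) (hI _)]
      simp only [signedIntegral] at t1 t2
      linarith
    have b1 : Integrable (fun t => (m1.rnDeriv l t).toReal • g t) l :=
      (integrable_rnDeriv_smul_iff h1).2 (hI _)
    have b2 : Integrable (fun t => (m2.rnDeriv l t).toReal • g t) l :=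
      (integrable_rnDeriv_smul_iff h2).2 (hI _)
    calc ∫ t, g t • ((m1.rnDeriv l t).toReal - (m2.rnDeriv l t).toReal) ∂l
        = ∫ t, ((m1.rnDeriv l t).toReal • g t - (m2.rnDeriv l t).toReal • g t) ∂l := by
          congr 1; ext t; simp only [smul_eq_mul]; ring
      _ = 0 := by rw [integral_sub b1 b2, e1, e2, t3, sub_self]
  have hout : ∀ᵐ t ∂l, t ∈ Ioo a b := by
    rw [ae_iff]
    change l (Ioo a b)ᶜ = 0
    simp [hl, hm1, hm2, hp, hn, hp', hn', cμ, cν]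
  have hr : m1.rnDeriv l =ᵐ[l] m2.rnDeriv l := by
    filter_upwards [key, hout, m1.rnDeriv_lt_top l, m2.rnDeriv_lt_top l] with t ht hm k1 k2
    exact (ENNReal.toReal_eq_toReal_iff' k1.ne k2.ne).1 (sub_eq_zero.1 (ht hm))
  have hmm : m1 = m2 := by
    rw [← Measure.withDensity_rnDeriv_eq m1 l h1, ← Measure.withDensity_rnDeriv_eq m2 l h2]
    exact withDensity_congr_ae hr
  have s1 := μ.toSignedMeasure_toJordanDecomposition
  have s2 := ν.toSignedMeasure_toJordanDecomposition
  have hs : p.toSignedMeasure + n'.toSignedMeasure = p'.toSignedMeasure + n.toSignedMeasure := by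
    rw [← Measure.toSignedMeasure_add, ← Measure.toSignedMeasure_add]
    exact Measure.toSignedMeasure_congr hmm
  rw [← s1, ← s2, JordanDecomposition.toSignedMeasure, JordanDecomposition.toSignedMeasure,
    sub_eq_sub_iff_add_eq_add]
  exact hs

theorem IsBV.distribDeriv_eq {a b : ℝ} {u : ℝ → ℝ} (h : IsBV a b u) {μ : SignedMeasure ℝ}
    (hμ : IsDistribDeriv a b u μ) : distribDeriv a b u = μ :=
  h.isDistribDeriv.unique hμ

end

end WeightedTV

namespace WeightedTV

open Filter Topology

/-! ### Differences of finite measures -/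

/-! Suppose `Du` has a positive atom at `x`. Move a small mass `ε` of it to another point `y` of
`Ω`, that is, replace `u` by `u - ε k` with `k = 1_{[x,∞)} - 1_{[y,∞)}`. The weighted variation
grows by at most `ε (α y - α x)`, and the fidelity term changes by `ε ∫_x^y (f - u) + O(ε²)`.
Minimality, after division by `ε` and `ε → 0`, gives `α x ≤ F y`, where `F y = α y + ∫_x^y (f - u)`
(`IsSolution.le_add_integral`). So `F` has a minimum over `Ω` at `x`.

If `α` is differentiable at `x`, the one-sided derivatives of `F` there are `α' x + f(x±) - u(x±)`;
the right one is `≥ 0` and the left one `≤ 0`. When `f` does not jump at `x`, subtracting them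
leaves `u(x+) ≤ u(x-)`, against the upward jump (`IsSolution.posPart_singleton_eq_zero`). Negative
atoms follow by passing to `-u` and `-f`.

One-sided limits exist because a BV function is a.e. a constant plus a difference of distribution
functions of finite measures (`IsDistribDeriv.exists_ae_eq`). -/

/-- `p` and `n` need not be mutually singular, so they may differ from the Jordan parts `μ⁺`, `μ⁻`;
but `μ⁺ + n = p + μ⁻` as measures, and this identity can be integrated. -/
theorem signedIntegral_sub (p n : Measure ℝ) [IsFiniteMeasure p] [IsFiniteMeasure n] {φ : ℝ → ℝ}
    (hφ : ∀ m : Measure ℝ, ∀ [IsFiniteMeasure m], Integrable φ m) :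
    signedIntegral (p.toSignedMeasure - n.toSignedMeasure) φ = (∫ t, φ t ∂p) - ∫ t, φ t ∂n := by
  set μ := p.toSignedMeasure - n.toSignedMeasure with hμ
  have h := μ.toSignedMeasure_toJordanDecomposition
  rw [JordanDecomposition.toSignedMeasure, hμ, sub_eq_sub_iff_add_eq_add, ← hμ,
    ← Measure.toSignedMeasure_add, ← Measure.toSignedMeasure_add,
    Measure.toSignedMeasure_eq_toSignedMeasure_iff] at h
  have h' : ∫ t, φ t ∂(_ + n) = ∫ t, φ t ∂(p + _) := congrArg (fun m => ∫ t, φ t ∂m) h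
  rw [integral_add_measure (hφ _) (hφ _), integral_add_measure (hφ _) (hφ _)] at h'
  simp only [signedIntegral]
  linarith

/-- On a Hahn set `i`, `μ⁺ s = p (i ∩ s) - n (i ∩ s) ≤ p s`, and symmetrically for `μ⁻` on the
complement. An upper bound suffices, since it is applied to the competitor of a minimiser. -/
theorem totalVariation_sub_le (p n : Measure ℝ) [IsFiniteMeasure p] [IsFiniteMeasure n] :
    (p.toSignedMeasure - n.toSignedMeasure).totalVariation ≤ p + n := by
  obtain ⟨i, hi, hi₂, hi₃, h₁, h₂⟩ :=
    (p.toSignedMeasure - n.toSignedMeasure).toJordanDecomposition_spec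
  rw [SignedMeasure.totalVariation]
  refine add_le_add ?_ ?_
  · refine Measure.le_iff.2 fun s hs => ?_
    rw [h₁, SignedMeasure.toMeasureOfZeroLE_apply _ _ hi hs,
      ← ENNReal.ofReal_eq_coe_nnreal, ENNReal.ofReal_le_iff_le_toReal (measure_ne_top _ _)]
    simp only [sub_eq_add_neg, FunLike.coe_add, FunLike.coe_neg, Pi.add_apply, Pi.neg_apply,
      Measure.toSignedMeasure_apply_measurable (hi.inter hs)]
    have : p.real (i ∩ s) ≤ p.real s := measureReal_mono inter_subset_right
    have h0 : 0 ≤ n.real (i ∩ s) := measureReal_nonneg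
    simp only [Measure.real] at *
    linarith
  · refine Measure.le_iff.2 fun s hs => ?_
    rw [h₂, SignedMeasure.toMeasureOfLEZero_apply _ _ hi.compl hs,
      ← ENNReal.ofReal_eq_coe_nnreal, ENNReal.ofReal_le_iff_le_toReal (measure_ne_top _ _)]
    simp only [sub_eq_add_neg, FunLike.coe_add, FunLike.coe_neg, Pi.add_apply, Pi.neg_apply,
      Measure.toSignedMeasure_apply_measurable (hi.compl.inter hs)]
    have : n.real (iᶜ ∩ s) ≤ n.real s := measureReal_mono inter_subset_right
    have h0 : 0 ≤ p.real (iᶜ ∩ s) := measureReal_nonneg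
    simp only [Measure.real] at *
    linarith

/-! ### Test functions -/

theorem IsTestFunction.integrable {a b : ℝ} {φ : ℝ → ℝ} (hφ : IsTestFunction a b φ)
    (m : Measure ℝ) [IsFiniteMeasureOnCompacts m] : Integrable φ m :=
  hφ.contDiff.continuous.integrable_of_hasCompactSupport hφ.hasCompactSupport

theorem IsTestFunction.continuous_deriv {a b : ℝ} {φ : ℝ → ℝ} (hφ : IsTestFunction a b φ) :
    Continuous (deriv φ) :=
  (contDiff_infty_iff_deriv.1 hφ.contDiff).2.continuous

theorem IsTestFunction.integrable_deriv {a b : ℝ} {φ : ℝ → ℝ} (hφ : IsTestFunction a b φ) :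
    Integrable (deriv φ) :=
  hφ.continuous_deriv.integrable_of_hasCompactSupport hφ.hasCompactSupport.deriv

theorem IsTestFunction.deriv_eq_zero {a b : ℝ} {φ : ℝ → ℝ} (hφ : IsTestFunction a b φ) {t : ℝ}
    (ht : t ∉ Ioo a b) : deriv φ t = 0 := by
  by_contra h
  exact ht (hφ.tsupport_subset (support_deriv_subset h))

theorem IsTestFunction.integrable_mul_deriv {a b : ℝ} {φ : ℝ → ℝ} (hφ : IsTestFunction a b φ)
    {g : ℝ → ℝ} {s : Set ℝ} (hg : IntegrableOn g s) :
    IntegrableOn (fun t => g t * deriv φ t) s := by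
  obtain ⟨C, hC⟩ := hφ.hasCompactSupport.deriv.exists_bound_of_continuous hφ.continuous_deriv
  exact hg.mul_bdd (c := C) hφ.continuous_deriv.aestronglyMeasurable
    (Eventually.of_forall hC)

/-! ### Distribution functions of finite measures -/

theorem monotone_real_Iic (p : Measure ℝ) [IsFiniteMeasure p] :
    Monotone fun t => p.real (Iic t) :=
  fun _ _ h => measureReal_mono (Iic_subset_Iic.2 h)

theorem norm_real_Iic_le (p : Measure ℝ) [IsFiniteMeasure p] (t : ℝ) :
    ‖p.real (Iic t)‖ ≤ p.real univ := by
  rw [Real.norm_of_nonneg measureReal_nonneg]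
  exact measureReal_mono (subset_univ _)

theorem integrableOn_real_Iic (p : Measure ℝ) [IsFiniteMeasure p] (a b : ℝ) :
    IntegrableOn (fun t => p.real (Iic t)) (Ioo a b) :=
  Measure.integrableOn_of_bounded (by simp) (monotone_real_Iic p).measurable.aestronglyMeasurable
    (Eventually.of_forall (norm_real_Iic_le p))

/-- The distribution function of a finite measure is a primitive of it. -/
theorem integral_real_Iic_mul_deriv (p : Measure ℝ) [IsFiniteMeasure p] {a b : ℝ} {φ : ℝ → ℝ}
    (hφ : IsTestFunction a b φ) :
    ∫ t in Ioo a b, p.real (Iic t) * deriv φ t = -∫ t, φ t ∂p := by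
  rw [setIntegral_eq_integral_of_forall_compl_eq_zero
    (fun t ht => by rw [hφ.deriv_eq_zero ht, mul_zero])]
  -- Fubini for `1_{s ≤ t} φ'(t)`: integrating in `s` gives `p (Iic t) φ'(t)`, integrating in `t`
  -- gives `-φ s`.
  have hS : MeasurableSet {z : ℝ × ℝ | z.2 ≤ z.1} := measurableSet_le measurable_snd measurable_fst
  have e1 : ∀ t, p.real (Iic t) * deriv φ t
      = ∫ s, {z : ℝ × ℝ | z.2 ≤ z.1}.indicator (fun z => deriv φ z.1) (t, s) ∂p := by
    intro t
    have : (fun s => {z : ℝ × ℝ | z.2 ≤ z.1}.indicator (fun z => deriv φ z.1) (t, s))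
        = (Iic t).indicator fun _ => deriv φ t := by
      ext s; simp [indicator]
    rw [this, integral_indicator_const _ measurableSet_Iic, smul_eq_mul]
  have e2 : ∀ s, ∫ t, {z : ℝ × ℝ | z.2 ≤ z.1}.indicator (fun z => deriv φ z.1) (t, s) = -φ s := by
    intro s
    have : (fun t => {z : ℝ × ℝ | z.2 ≤ z.1}.indicator (fun z => deriv φ z.1) (t, s))
        = (Ici s).indicator (deriv φ) := by
      ext t; simp [indicator]
    rw [this, integral_indicator measurableSet_Ici, integral_Ici_eq_integral_Ioi,
      hφ.hasCompactSupport.integral_Ioi_deriv_eq (hφ.contDiff.of_le (by simp))]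
  simp_rw [e1]
  rw [integral_integral_swap (f := fun t s =>
    {z : ℝ × ℝ | z.2 ≤ z.1}.indicator (fun z => deriv φ z.1) (t, s))]
  · simp_rw [e2]
    rw [integral_neg]
  · exact (hφ.integrable_deriv.comp_fst p).indicator hS

theorem tendsto_real_Iic_right (p : Measure ℝ) [IsFiniteMeasure p] (x : ℝ) :
    Tendsto (fun t => p.real (Iic t)) (𝓝[>] x) (𝓝 (p.real (Iic x))) := by
  refine (ENNReal.tendsto_toReal (measure_ne_top _ _)).comp
    (tendsto_measure_of_tendsto_indicator_of_isFiniteMeasure _ _ (fun _ => measurableSet_Iic) ?_)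
  intro s
  rcases le_or_gt s x with h | h
  · filter_upwards [self_mem_nhdsWithin] with t ht
    exact ⟨fun _ => h, fun _ => h.trans (le_of_lt ht)⟩
  · filter_upwards [Ioo_mem_nhdsGT h] with t ht
    exact ⟨fun h' => absurd h' ht.2.not_ge, fun h' => absurd h' h.not_ge⟩

theorem tendsto_real_Iic_left (p : Measure ℝ) [IsFiniteMeasure p] (x : ℝ) :
    Tendsto (fun t => p.real (Iic t)) (𝓝[<] x) (𝓝 (p.real (Iio x))) := by
  refine (ENNReal.tendsto_toReal (measure_ne_top _ _)).comp
    (tendsto_measure_of_tendsto_indicator_of_isFiniteMeasure _ _ (fun _ => measurableSet_Iic) ?_)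
  intro s
  rcases lt_or_ge s x with h | h
  · filter_upwards [Ioo_mem_nhdsLT h] with t ht
    exact ⟨fun _ => h, fun _ => ht.1.le⟩
  · filter_upwards [self_mem_nhdsWithin] with t ht
    exact ⟨fun h' => absurd (h.trans h') (not_le.2 ht), fun h' => absurd h' h.not_gt⟩

theorem real_Iic_eq (p : Measure ℝ) [IsFiniteMeasure p] (x : ℝ) :
    p.real (Iic x) = p.real (Iio x) + p.real {x} := by
  rw [← Iio_union_right, measureReal_union (by simp) (measurableSet_singleton x)]

/-! ### Functions with vanishing distributional derivative -/

/-- The primitive from `-∞` vanishes to the left of the support of `ρ`, and to its right because the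
total integral is zero. -/
theorem exists_isTestFunction_deriv {a b : ℝ} {ρ : ℝ → ℝ} (hρ : IsTestFunction a b ρ)
    (h0 : ∫ t, ρ t = 0) : ∃ φ, IsTestFunction a b φ ∧ deriv φ = ρ := by
  have hc := hρ.contDiff.continuous
  have hi : Integrable ρ := hρ.integrable volume
  obtain ⟨c, d, hac, hdb, hsub⟩ : ∃ c d, a < c ∧ d < b ∧ tsupport ρ ⊆ Icc c d := by
    rcases (tsupport ρ).eq_empty_or_nonempty with h | h
    · exact ⟨a + 1, b - 1, by linarith, by linarith, by simp [h]⟩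
    · have hK : IsCompact (tsupport ρ) := hρ.hasCompactSupport
      obtain ⟨c, hc⟩ := hK.exists_isLeast h
      obtain ⟨d, hd⟩ := hK.exists_isGreatest h
      exact ⟨c, d, (hρ.tsupport_subset hc.1).1, (hρ.tsupport_subset hd.1).2,
        fun t ht => ⟨hc.2 ht, hd.2 ht⟩⟩
  have hz : ∀ t, t ∉ Icc c d → ρ t = 0 := fun t ht =>
    image_eq_zero_of_notMem_tsupport fun h => ht (hsub h)
  have hd : ∀ t, HasDerivAt (fun t => ∫ s in Iic t, ρ s) (ρ t) t := by
    intro t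
    have : (fun t => ∫ s in Iic t, ρ s)
        = fun t => (∫ s in Iic (0 : ℝ), ρ s) + ∫ s in (0 : ℝ)..t, ρ s := by
      ext t
      rw [← intervalIntegral.integral_Iic_sub_Iic hi.integrableOn hi.integrableOn]
      ring
    rw [this]
    exact (intervalIntegral.integral_hasDerivAt_right (hc.intervalIntegrable _ _)
      (hc.stronglyMeasurableAtFilter _ _) hc.continuousAt).const_add _
  have hderiv : deriv (fun t => ∫ s in Iic t, ρ s) = ρ := funext fun t => (hd t).deriv
  have hsupp : Function.support (fun t => ∫ s in Iic t, ρ s) ⊆ Icc c d := by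
    intro t ht
    by_contra hn
    refine ht ?_
    rw [mem_Icc, not_and_or, not_le, not_le] at hn
    rcases hn with hn | hn
    · exact setIntegral_eq_zero_of_forall_eq_zero fun s hs =>
        hz s fun h => absurd (h.1.trans hs) (not_le.2 hn)
    · change ∫ s in Iic t, ρ s = 0
      rw [setIntegral_eq_integral_of_forall_compl_eq_zero, h0]
      intro s hs
      exact hz s fun h => hs (h.2.trans hn.le)
  have hts := closure_minimal hsupp isClosed_Icc
  refine ⟨fun t => ∫ s in Iic t, ρ s, ⟨?_, ?_, ?_⟩, hderiv⟩
  · exact contDiff_infty_iff_deriv.2 ⟨fun t => (hd t).differentiableAt, by rw [hderiv]; exact hρ.contDiff⟩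
  · exact HasCompactSupport.of_support_subset_isCompact isCompact_Icc hsupp
  · exact hts.trans fun t ht => ⟨hac.trans_le ht.1, ht.2.trans_lt hdb⟩

/-- The du Bois-Reymond lemma. -/
theorem exists_ae_eq_const {a b : ℝ} (hab : a < b) {h : ℝ → ℝ} (hh : IntegrableOn h (Ioo a b))
    (h0 : ∀ φ, IsTestFunction a b φ → ∫ t in Ioo a b, h t * deriv φ t = 0) :
    ∃ C, ∀ᵐ t, t ∈ Ioo a b → h t = C := by
  obtain ⟨ψ, hψs, hψc, hψd, hψr, hψ1⟩ :=
    exists_contDiff_tsupport_subset (n := ⊤)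
      (Ioo_mem_nhds (left_lt_add_div_two.2 hab) (add_div_two_lt_right.2 hab))
  have hψ : IsTestFunction a b ψ := ⟨hψd, hψc, hψs⟩
  have hψi : Integrable ψ := hψ.integrable volume
  have hpos : 0 < ∫ t, ψ t :=
    hψd.continuous.integral_pos_of_hasCompactSupport_nonneg_nonzero hψc
      (fun t => (hψr (mem_range_self t)).1) (x := (a + b) / 2) (by rw [hψ1]; exact one_ne_zero)
  have hmul : ∀ η, IsTestFunction a b η → IntegrableOn (fun t => h t * η t) (Ioo a b) := by
    intro η hη
    obtain ⟨C, hC⟩ := hη.hasCompactSupport.exists_bound_of_continuous hη.contDiff.continuous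
    exact hh.mul_bdd (c := C) hη.contDiff.continuous.aestronglyMeasurable (Eventually.of_forall hC)
  set C := (∫ t in Ioo a b, h t * ψ t) / ∫ t, ψ t with hC
  refine ⟨C, ?_⟩
  have key : ∀ᵐ t, t ∈ Ioo a b → h t - C = 0 := by
    refine isOpen_Ioo.ae_eq_zero_of_integral_contDiff_smul_eq_zero
      (hh.sub (integrableOn_const (by simp))).locallyIntegrableOn ?_
    intro η hηd hηc hηs
    have hη : IsTestFunction a b η := ⟨hηd, hηc, hηs⟩
    have hηi : Integrable η := hη.integrable volume
    -- With this `r`, `η - r ψ` has integral zero and is therefore the derivative of a test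
    -- function.
    set r := (∫ t, η t) / ∫ t, ψ t with hr
    have hρ : IsTestFunction a b fun t => η t - r * ψ t :=
      ⟨hηd.sub (contDiff_const.mul hψd), hηc.sub (hψc.mul_left (f := fun _ => r)),
        (tsupport_sub _ _).trans (union_subset hηs
          ((tsupport_mul_subset_right (f := fun _ => r)).trans hψs))⟩
    obtain ⟨φ, hφ, hφd⟩ := exists_isTestFunction_deriv hρ (by
      rw [integral_sub hηi (hψi.const_mul r), integral_const_mul, hr,
        div_mul_cancel₀ _ hpos.ne', sub_self])
    have e := h0 φ hφ
    simp only [hφd, mul_sub] at e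
    rw [integral_sub (hmul η hη) (by
      simpa only [mul_left_comm] using (hmul ψ hψ).const_mul r)] at e
    simp only [mul_left_comm _ r] at e
    rw [integral_const_mul] at e
    have e3 : ∫ t in Ioo a b, η t = ∫ t, η t :=
      setIntegral_eq_integral_of_forall_compl_eq_zero fun t ht =>
        image_eq_zero_of_notMem_tsupport fun h => ht (hηs h)
    rw [← setIntegral_eq_integral_of_forall_compl_eq_zero (s := Ioo a b) (fun t ht => by
      rw [image_eq_zero_of_notMem_tsupport fun h => ht (hηs h), zero_smul])]
    simp only [smul_eq_mul, mul_sub]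
    rw [integral_sub (by simpa only [mul_comm, IntegrableOn] using hmul η hη) (hηi.integrableOn.mul_const C),
      integral_mul_const, e3]
    simp only [mul_comm (η _)]
    have : r * ∫ t in Ioo a b, h t * ψ t = (∫ t, η t) * C := by
      rw [hr, hC]; ring
    linarith
  filter_upwards [key] with t ht hm
  exact sub_eq_zero.1 (ht hm)

/-! ### Functions of bounded variation -/

theorem IsDistribDeriv.of_sub {a b : ℝ} {w : ℝ → ℝ} (p n : Measure ℝ) [IsFiniteMeasure p]
    [IsFiniteMeasure n] (hp : p (Ioo a b)ᶜ = 0) (hn : n (Ioo a b)ᶜ = 0)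
    (h : ∀ φ, IsTestFunction a b φ →
      ∫ t in Ioo a b, w t * deriv φ t = -((∫ t, φ t ∂p) - ∫ t, φ t ∂n)) :
    IsDistribDeriv a b w (p.toSignedMeasure - n.toSignedMeasure) where
  concentrated := le_antisymm
    ((totalVariation_sub_le p n _).trans (by simp [hp, hn])) zero_le
  integral_deriv φ hφ := by
    rw [h φ hφ, signedIntegral_sub p n fun m _ => hφ.integrable m]

theorem IsDistribDeriv.neg {a b : ℝ} {u : ℝ → ℝ} {μ : SignedMeasure ℝ}
    (h : IsDistribDeriv a b u μ) : IsDistribDeriv a b (fun t => -u t) (-μ) where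
  concentrated := by rw [SignedMeasure.totalVariation_neg, h.concentrated]
  integral_deriv φ hφ := by
    have e := h.integral_deriv φ hφ
    simp only [neg_mul, integral_neg, e, signedIntegral, SignedMeasure.toJordanDecomposition_neg,
      JordanDecomposition.neg_posPart, JordanDecomposition.neg_negPart]
    ring

theorem IsBV.neg {a b : ℝ} {u : ℝ → ℝ} (h : IsBV a b u) : IsBV a b fun t => -u t :=
  ⟨h.1.neg, _, h.isDistribDeriv.neg⟩

theorem IsBV.distribDeriv_neg {a b : ℝ} {u : ℝ → ℝ} (h : IsBV a b u) :
    distribDeriv a b (fun t => -u t) = -distribDeriv a b u :=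
  h.neg.distribDeriv_eq h.isDistribDeriv.neg

theorem IsBV.derivVariation_neg {a b : ℝ} {u : ℝ → ℝ} (h : IsBV a b u) :
    derivVariation a b (fun t => -u t) = derivVariation a b u := by
  rw [derivVariation, h.distribDeriv_neg, SignedMeasure.totalVariation_neg, derivVariation]

theorem IsBV.jumpSet_neg {a b : ℝ} {u : ℝ → ℝ} (h : IsBV a b u) :
    jumpSet a b (fun t => -u t) = jumpSet a b u := by
  rw [jumpSet, h.derivVariation_neg, jumpSet]

theorem IsBV.energy_neg {a b : ℝ} {u : ℝ → ℝ} (h : IsBV a b u) (α f : ℝ → ℝ) :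
    energy a b α (fun t => -f t) (fun t => -u t) = energy a b α f u := by
  rw [energy, h.derivVariation_neg, energy]
  congr 3
  ext t
  ring

theorem IsSolution.neg {a b : ℝ} {α f u : ℝ → ℝ} (h : IsSolution a b α f u) :
    IsSolution a b α (fun t => -f t) fun t => -u t := by
  refine ⟨h.1.neg, fun w hw => ?_⟩
  have e := hw.neg.energy_neg α f
  simp only [neg_neg] at e
  rw [h.1.energy_neg, e]
  exact h.2 _ hw.neg

/-- A function of bounded variation is almost everywhere equal to a difference of distribution
functions. -/
theorem IsDistribDeriv.exists_ae_eq {a b : ℝ} (hab : a < b) {u : ℝ → ℝ} {μ : SignedMeasure ℝ}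
    (hu : IntegrableOn u (Ioo a b)) (h : IsDistribDeriv a b u μ) :
    ∃ C, ∀ᵐ t, t ∈ Ioo a b → u t = C + (μ.toJordanDecomposition.posPart.real (Iic t)
      - μ.toJordanDecomposition.negPart.real (Iic t)) := by
  set p := μ.toJordanDecomposition.posPart
  set n := μ.toJordanDecomposition.negPart
  have ip := integrableOn_real_Iic p a b
  have im := integrableOn_real_Iic n a b
  obtain ⟨C, hC⟩ := exists_ae_eq_const hab
    (h := fun t => u t - (p.real (Iic t) - n.real (Iic t))) (hu.sub (ip.sub im)) (by
    intro φ hφ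
    have j1 := hφ.integrable_mul_deriv hu
    have j2 := hφ.integrable_mul_deriv ip
    have j3 := hφ.integrable_mul_deriv im
    have j4 : IntegrableOn (fun t => p.real (Iic t) * deriv φ t - n.real (Iic t) * deriv φ t)
        (Ioo a b) := j2.sub j3
    simp only [sub_mul]
    have e : ∫ t in Ioo a b, u t * deriv φ t = -((∫ t, φ t ∂p) - ∫ t, φ t ∂n) :=
      h.integral_deriv φ hφ
    rw [integral_sub j1 j4, integral_sub j2 j3, integral_real_Iic_mul_deriv p hφ,
      integral_real_Iic_mul_deriv n hφ, e]
    ring)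
  refine ⟨C, ?_⟩
  filter_upwards [hC] with t ht hm
  linarith [ht hm]

theorem IsBV.exists_ae_eq {a b : ℝ} (hab : a < b) {u : ℝ → ℝ} (hu : IsBV a b u) :
    ∃ C, ∀ᵐ t, t ∈ Ioo a b →
      u t = C + ((distribDeriv a b u).toJordanDecomposition.posPart.real (Iic t)
        - (distribDeriv a b u).toJordanDecomposition.negPart.real (Iic t)) :=
  hu.isDistribDeriv.exists_ae_eq hab hu.1

theorem IsBV.exists_ae_bound {a b : ℝ} (hab : a < b) {u : ℝ → ℝ} (hu : IsBV a b u) :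
    ∃ M, ∀ᵐ t, t ∈ Ioo a b → ‖u t‖ ≤ M := by
  obtain ⟨C, hC⟩ := hu.exists_ae_eq hab
  set p := (distribDeriv a b u).toJordanDecomposition.posPart
  set n := (distribDeriv a b u).toJordanDecomposition.negPart
  refine ⟨‖C‖ + (p.real univ + n.real univ), ?_⟩
  filter_upwards [hC] with t ht hm
  rw [ht hm]
  exact (norm_add_le _ _).trans (add_le_add_right ((norm_sub_le _ _).trans
    (add_le_add (norm_real_Iic_le p t) (norm_real_Iic_le n t))) _)

/-- The limits are taken along `𝓝[>] x` and `𝓝[≤] x` intersected with `ae`, as the one-sided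
fundamental theorem of calculus requires. Including `x` on the left is harmless, since a point is
null. -/
theorem tendsto_one_sided_of_ae_eq {a b C x : ℝ} (hx : x ∈ Ioo a b) {u : ℝ → ℝ} (p n : Measure ℝ)
    [IsFiniteMeasure p] [IsFiniteMeasure n]
    (h : ∀ᵐ t, t ∈ Ioo a b → u t = C + (p.real (Iic t) - n.real (Iic t))) :
    Tendsto u (𝓝[>] x ⊓ ae volume) (𝓝 (C + (p.real (Iic x) - n.real (Iic x)))) ∧
    Tendsto u (𝓝[≤] x ⊓ ae volume) (𝓝 (C + (p.real (Iio x) - n.real (Iio x)))) := by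
  have key : ∀ s : Set ℝ, (fun t => C + (p.real (Iic t) - n.real (Iic t)))
      =ᶠ[𝓝[s] x ⊓ ae volume] u := by
    intro s
    have h1 : ∀ᶠ t in 𝓝[s] x, t ∈ Ioo a b := mem_nhdsWithin_of_mem_nhds (Ioo_mem_nhds hx.1 hx.2)
    filter_upwards [h1.filter_mono inf_le_left, h.filter_mono inf_le_right] with t h1 h2
    exact (h2 h1).symm
  have hle : 𝓝[≤] x ⊓ ae volume ≤ 𝓝[<] x := by
    refine le_inf (inf_le_left.trans nhdsWithin_le_nhds) (le_principal_iff.2 ?_)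
    have h1 : ∀ᶠ t in 𝓝[≤] x, t ≤ x := self_mem_nhdsWithin
    have h2 : ∀ᵐ t : ℝ, t ≠ x := Measure.ae_ne volume x
    filter_upwards [h1.filter_mono inf_le_left, h2.filter_mono inf_le_right] with t h1 h2
    exact lt_of_le_of_ne h1 h2
  exact ⟨Tendsto.congr' (key _) ((((tendsto_real_Iic_right p x).sub
      (tendsto_real_Iic_right n x)).const_add C).mono_left inf_le_left),
    Tendsto.congr' (key _) ((((tendsto_real_Iic_left p x).sub
      (tendsto_real_Iic_left n x)).const_add C).mono_left hle)⟩

/-! ### Shifting a part of a jump -/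

theorem dirac_real_Iic (x t : ℝ) :
    (Measure.dirac x).real (Iic t) = (Ici x).indicator (fun _ => (1 : ℝ)) t := by
  by_cases h : x ≤ t <;> simp [Measure.real, h]

theorem setIntegral_mul_dirac_real_Iic {a b x : ℝ} (hx : x ∈ Ioo a b) (g : ℝ → ℝ) :
    ∫ t in Ioo a b, g t * (Measure.dirac x).real (Iic t) = ∫ t in x..b, g t := by
  have : (fun t => g t * (Measure.dirac x).real (Iic t)) = (Ici x).indicator g := by
    ext t
    by_cases h : x ≤ t <;> simp [dirac_real_Iic, h]
  rw [this, setIntegral_indicator measurableSet_Ici, intervalIntegral.integral_of_le hx.2.le,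
    integral_Ioc_eq_integral_Ioo, ← integral_Ico_eq_integral_Ioo]
  congr 2
  ext t
  exact ⟨fun h => ⟨h.2, h.1.2⟩, fun h => ⟨⟨hx.1.trans_le h.1, h.2⟩, h.1⟩⟩

/-- Moving the mass `ε` of an upward jump of `u` from `x` to `y`. -/
theorem IsDistribDeriv.shift_jump {a b x y : ℝ} (hy : y ∈ Ioo a b)
    {u : ℝ → ℝ} {μ : SignedMeasure ℝ} (hu : IntegrableOn u (Ioo a b))
    (h : IsDistribDeriv a b u μ) {ε : NNReal} (hε : ε ≤ μ.toJordanDecomposition.posPart {x}) :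
    ∃ ν : SignedMeasure ℝ,
      IsDistribDeriv a b (fun t => u t - ε * ((Measure.dirac x).real (Iic t)
        - (Measure.dirac y).real (Iic t))) ν ∧
      ν.totalVariation + ε • Measure.dirac x ≤ μ.totalVariation + ε • Measure.dirac y := by
  set p := μ.toJordanDecomposition.posPart with hp
  set n := μ.toJordanDecomposition.negPart with hn
  have hle : ε • Measure.dirac x ≤ p := by
    refine Measure.le_iff.2 fun s hs => ?_
    by_cases hxs : x ∈ s
    · have : p {x} ≤ p s := measure_mono (singleton_subset_iff.2 hxs)
      rw [Measure.smul_apply, Measure.dirac_apply' x hs, indicator_of_mem hxs, Pi.one_apply,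
        ENNReal.smul_def, smul_eq_mul, mul_one]
      exact hε.trans this
    · simp [Measure.dirac_apply' x hs, hxs]
  -- Splitting off the mass to be moved; the new derivative is `q + ε δ_y - n`.
  obtain ⟨q, hq, hpq⟩ : ∃ q : Measure ℝ, IsFiniteMeasure q ∧ p = q + ε • Measure.dirac x :=
    ⟨p - ε • Measure.dirac x, inferInstance, (Measure.sub_add_cancel_of_le hle).symm⟩
  have hc := h.concentrated
  simp only [SignedMeasure.totalVariation, ← hp, ← hn, Measure.coe_add, Pi.add_apply,
    add_eq_zero] at hc
  refine ⟨(q + ε • Measure.dirac y).toSignedMeasure - n.toSignedMeasure,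
    IsDistribDeriv.of_sub _ _ ?_ hc.2 ?_, ?_⟩
  · have : q (Ioo a b)ᶜ = 0 := by
      have := hc.1
      rw [hpq, Measure.coe_add, Pi.add_apply, add_eq_zero] at this
      exact this.1
    simp [this, Measure.dirac_apply' y measurableSet_Ioo.compl, hy.1, hy.2]
  · intro φ hφ
    have e : ∫ t in Ioo a b, u t * deriv φ t = -((∫ t, φ t ∂p) - ∫ t, φ t ∂n) :=
      h.integral_deriv φ hφ
    have j1 := hφ.integrable_mul_deriv hu
    have j2 := hφ.integrable_mul_deriv (integrableOn_real_Iic (Measure.dirac x) a b)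
    have j3 := hφ.integrable_mul_deriv (integrableOn_real_Iic (Measure.dirac y) a b)
    have j4 : IntegrableOn (fun t => ε * ((Measure.dirac x).real (Iic t) * deriv φ t
        - (Measure.dirac y).real (Iic t) * deriv φ t)) (Ioo a b) := (j2.sub j3).const_mul _
    simp only [sub_mul, mul_assoc]
    rw [integral_sub j1 j4, integral_const_mul, integral_sub j2 j3,
      integral_real_Iic_mul_deriv _ hφ, integral_real_Iic_mul_deriv _ hφ, e, hpq,
      integral_add_measure (hφ.integrable _) (hφ.integrable _),
      integral_add_measure (hφ.integrable _) (hφ.integrable _),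
      integral_smul_nnreal_measure, integral_smul_nnreal_measure, integral_dirac, integral_dirac]
    simp only [NNReal.smul_def, smul_eq_mul]
    ring
  · refine (add_le_add_left (totalVariation_sub_le _ _) _).trans_eq ?_
    rw [SignedMeasure.totalVariation, ← hp, ← hn, hpq]
    abel

theorem integrableOn_of_continuousOn_Icc {a b : ℝ} {α : ℝ → ℝ} (hα : ContinuousOn α (Icc a b))
    (m : Measure ℝ) [IsFiniteMeasure m] : IntegrableOn α (Ioo a b) m :=
  (hα.integrableOn_compact isCompact_Icc).mono_set Ioo_subset_Icc_self

theorem setIntegral_add_smul_dirac {a b x : ℝ} (hx : x ∈ Ioo a b) {α : ℝ → ℝ}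
    (hα : ContinuousOn α (Icc a b)) (m : Measure ℝ) [IsFiniteMeasure m] (ε : NNReal) :
    ∫ t in Ioo a b, α t ∂(m + ε • Measure.dirac x) = (∫ t in Ioo a b, α t ∂m) + ε * α x := by
  classical
  rw [Measure.restrict_add, integral_add_measure (integrableOn_of_continuousOn_Icc hα m)
    (integrableOn_of_continuousOn_Icc hα _), Measure.restrict_smul, integral_smul_nnreal_measure,
    setIntegral_dirac, if_pos hx, NNReal.smul_def, smul_eq_mul]

theorem isFiniteMeasure_totalVariation (μ : SignedMeasure ℝ) :
    IsFiniteMeasure μ.totalVariation := by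
  rw [SignedMeasure.totalVariation]
  infer_instance

theorem IsSolution.le_add_integral {a b x y : ℝ} (hab : a < b) {f α u : ℝ → ℝ} (hf : IsBV a b f)
    (hα : ContinuousOn α (Icc a b)) (hα0 : ∀ t ∈ Icc a b, 0 ≤ α t)
    (hu : IsSolution a b α f u) (hx : x ∈ Ioo a b) (hy : y ∈ Ioo a b)
    (hjump : (distribDeriv a b u).toJordanDecomposition.posPart {x} ≠ 0) :
    α x ≤ α y + ∫ t in x..y, (f t - u t) := by
  set k : ℝ → ℝ := fun t => (Measure.dirac x).real (Iic t) - (Measure.dirac y).real (Iic t) with hk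
  set g : ℝ → ℝ := fun t => f t - u t with hg
  have hgi : IntegrableOn g (Ioo a b) := hf.1.sub hu.1.1
  have hki : IntegrableOn k (Ioo a b) :=
    (integrableOn_real_Iic _ a b).sub (integrableOn_real_Iic _ a b)
  have hkb : ∀ t, ‖k t‖ ≤ 2 := fun t => by
    refine (norm_sub_le _ _).trans ?_
    have h1 := norm_real_Iic_le (Measure.dirac x) t
    have h2 := norm_real_Iic_le (Measure.dirac y) t
    simp only [probReal_univ] at h1 h2
    linarith
  have hgk : IntegrableOn (fun t => g t * k t) (Ioo a b) :=
    hgi.mul_bdd (c := 2) hki.aestronglyMeasurable (Eventually.of_forall hkb)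
  have hkk : IntegrableOn (fun t => k t * k t) (Ioo a b) :=
    hki.mul_bdd (c := 2) hki.aestronglyMeasurable (Eventually.of_forall hkb)
  -- BV functions of one variable are essentially bounded, so the square in the energy can be
  -- expanded term by term.
  have hgg : IntegrableOn (fun t => g t * g t) (Ioo a b) := by
    obtain ⟨M, hM⟩ := hf.exists_ae_bound hab
    obtain ⟨M', hM'⟩ := hu.1.exists_ae_bound hab
    refine hgi.mul_bdd (c := M + M') hgi.aestronglyMeasurable
      ((ae_restrict_iff' measurableSet_Ioo).2 ?_)
    filter_upwards [hM, hM'] with t h1 h2 ht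
    exact (norm_sub_le _ _).trans (add_le_add (h1 ht) (h2 ht))
  -- The difference of the integrals over `[x, b]` and `[y, b]`; the oriented integral covers both
  -- orders of `x` and `y`.
  have hgk_eq : ∫ t in Ioo a b, g t * k t = ∫ t in x..y, g t := by
    have hI : ∀ z ∈ Ioo a b, IntervalIntegrable g volume z b := fun z hz =>
      (intervalIntegrable_iff_integrableOn_Ioo_of_le hz.2.le).2
        (hgi.mono_set (Ioo_subset_Ioo_left hz.1.le))
    have hD : ∀ z, IntegrableOn (fun t => g t * (Measure.dirac z).real (Iic t)) (Ioo a b) :=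
      fun z => hgi.mul_bdd (c := (Measure.dirac z).real univ)
        (integrableOn_real_Iic _ a b).aestronglyMeasurable
        (Eventually.of_forall (norm_real_Iic_le _))
    simp only [hk, mul_sub]
    rw [integral_sub (hD x) (hD y), setIntegral_mul_dirac_real_Iic hx,
      setIntegral_mul_dirac_real_Iic hy,
      ← intervalIntegral.integral_add_adjacent_intervals ((hI x hx).trans (hI y hy).symm) (hI y hy)]
    ring
  set K := ∫ t in Ioo a b, k t * k t
  have hstep : ∀ ε : NNReal, 0 < ε →
      ε ≤ (distribDeriv a b u).toJordanDecomposition.posPart {x} →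
      0 ≤ α y - α x + (∫ t in x..y, g t) + ε * (K / 2) := by
    intro ε hε0 hε
    obtain ⟨ν, hν, hle⟩ := hu.1.isDistribDeriv.shift_jump hy hu.1.1 hε
    have hw : IsBV a b (fun t => u t - ε * k t) := ⟨hu.1.1.sub (hki.const_mul _), ν, hν⟩
    have hmin := hu.2 _ hw
    have := isFiniteMeasure_totalVariation ν
    have := isFiniteMeasure_totalVariation (distribDeriv a b u)
    -- Here `0 ≤ α` enters: it makes the integral of `α` monotone in the measure.
    have hvar := integral_mono_measure (f := α) (Measure.restrict_mono_measure hle (Ioo a b))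
      (ae_restrict_of_forall_mem measurableSet_Ioo fun t ht => hα0 t (Ioo_subset_Icc_self ht))
      (integrableOn_of_continuousOn_Icc hα _)
    rw [setIntegral_add_smul_dirac hx hα, setIntegral_add_smul_dirac hy hα] at hvar
    have hsq : ∫ t in Ioo a b, (f t - (u t - ε * k t)) ^ 2
        = (∫ t in Ioo a b, (f t - u t) ^ 2) + (2 * ε * (∫ t in x..y, g t) + ε ^ 2 * K) := by
      have e1 : ∀ t, (f t - (u t - ε * k t)) ^ 2
          = g t * g t + (2 * ε * (g t * k t) + ε ^ 2 * (k t * k t)) := fun t => by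
        simp only [hg]; ring
      have e2 : ∀ t, (f t - u t) ^ 2 = g t * g t := fun t => by simp only [hg]; ring
      have e3 : IntegrableOn (fun t => 2 * ε * (g t * k t) + ε ^ 2 * (k t * k t)) (Ioo a b) :=
        (hgk.const_mul _).add (hkk.const_mul _)
      simp_rw [e1, e2]
      rw [integral_add hgg e3,
        integral_add (hgk.const_mul _) (hkk.const_mul _), integral_const_mul, integral_const_mul,
        hgk_eq]
    simp only [energy, derivVariation, hw.distribDeriv_eq hν, hsq] at hmin
    have hε0' : (0 : ℝ) < ε := hε0
    refine nonneg_of_mul_nonneg_right (a := (ε : ℝ)) ?_ hε0'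
    nlinarith
  have hlim : Tendsto (fun ε : NNReal => α y - α x + (∫ t in x..y, g t) + ε * (K / 2)) (𝓝[>] 0)
      (𝓝 (α y - α x + (∫ t in x..y, g t) + ((0 : NNReal) : ℝ) * (K / 2))) :=
    Continuous.tendsto' (by fun_prop) _ _ rfl |>.mono_left nhdsWithin_le_nhds
  have hev : ∀ᶠ ε : NNReal in 𝓝[>] 0,
      0 ≤ α y - α x + (∫ t in x..y, g t) + ε * (K / 2) := by
    have h1 : ∀ᶠ ε : NNReal in 𝓝 0,
        (ε : ENNReal) < (distribDeriv a b u).toJordanDecomposition.posPart {x} :=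
      (ENNReal.continuous_coe.tendsto 0).eventually_lt_const (by
        simpa using pos_iff_ne_zero.2 hjump)
    filter_upwards [self_mem_nhdsWithin, mem_nhdsWithin_of_mem_nhds h1] with ε h2 h3
    exact hstep ε h2 h3.le
  have := ge_of_tendsto hlim hev
  rw [NNReal.coe_zero, zero_mul, add_zero] at this
  linarith

/-! ### The jump set of the minimiser -/

theorem nonneg_of_hasDerivWithinAt_Ici {F : ℝ → ℝ} {L x : ℝ}
    (h : HasDerivWithinAt F L (Ici x) x) (hmin : ∀ᶠ y in 𝓝[>] x, F x ≤ F y) : 0 ≤ L := by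
  rw [← hasDerivWithinAt_Ioi_iff_Ici, hasDerivWithinAt_iff_tendsto_slope' self_notMem_Ioi] at h
  refine ge_of_tendsto h ?_
  filter_upwards [hmin, self_mem_nhdsWithin] with y hy hxy
  rw [slope_def_field]
  exact div_nonneg (sub_nonneg.2 hy) (sub_nonneg.2 (le_of_lt hxy))

theorem nonpos_of_hasDerivWithinAt_Iic {F : ℝ → ℝ} {L x : ℝ}
    (h : HasDerivWithinAt F L (Iic x) x) (hmin : ∀ᶠ y in 𝓝[<] x, F x ≤ F y) : L ≤ 0 := by
  rw [← hasDerivWithinAt_Iio_iff_Iic, hasDerivWithinAt_iff_tendsto_slope' self_notMem_Iio] at h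
  refine le_of_tendsto h ?_
  filter_upwards [hmin, self_mem_nhdsWithin] with y hy hxy
  rw [slope_def_field]
  exact div_nonpos_of_nonneg_of_nonpos (sub_nonneg.2 hy) (sub_nonpos.2 (le_of_lt hxy))

theorem IsSolution.posPart_singleton_eq_zero {a b x : ℝ} (hab : a < b) {f α u : ℝ → ℝ}
    (hf : IsBV a b f) (hα : ContinuousOn α (Icc a b)) (hα0 : ∀ t ∈ Icc a b, 0 ≤ α t)
    (hu : IsSolution a b α f u) (hx : x ∈ Ioo a b) (hαx : DifferentiableAt ℝ α x)
    (hfx : x ∉ jumpSet a b f) :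
    (distribDeriv a b u).toJordanDecomposition.posPart {x} = 0 := by
  by_contra hjump
  have hF : ∀ y ∈ Ioo a b, α x ≤ α y + ∫ t in x..y, (f t - u t) := fun y hy =>
    hu.le_add_integral hab hf hα hα0 hx hy hjump
  have hnhds : Ioo a b ∈ 𝓝 x := Ioo_mem_nhds hx.1 hx.2
  have hfx' : derivVariation a b f {x} = 0 := by
    by_contra h
    exact hfx ⟨hx, h⟩
  rw [derivVariation, SignedMeasure.totalVariation, Measure.coe_add, Pi.add_apply,
    add_eq_zero] at hfx'
  -- The Jordan parts are mutually singular, so they cannot both charge `x`; hence `u(x+) - u(x-) =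
  -- p {x}`.
  have hneg : (distribDeriv a b u).toJordanDecomposition.negPart {x} = 0 := by
    obtain ⟨S, -, hS1, hS2⟩ := (distribDeriv a b u).toJordanDecomposition.mutuallySingular
    have hxS : x ∈ Sᶜ := fun h =>
      hjump (measure_mono_null (singleton_subset_iff.2 h) hS1)
    exact measure_mono_null (singleton_subset_iff.2 hxS) hS2
  obtain ⟨C, hC⟩ := hu.1.exists_ae_eq hab
  obtain ⟨C', hC'⟩ := hf.exists_ae_eq hab
  obtain ⟨ur, ul⟩ := tendsto_one_sided_of_ae_eq hx _ _ hC
  obtain ⟨fr, fl⟩ := tendsto_one_sided_of_ae_eq hx _ _ hC'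
  simp only [real_Iic_eq] at ur fr
  set p := (distribDeriv a b u).toJordanDecomposition.posPart
  set n := (distribDeriv a b u).toJordanDecomposition.negPart
  set p' := (distribDeriv a b f).toJordanDecomposition.posPart
  set n' := (distribDeriv a b f).toJordanDecomposition.negPart
  have hpx : 0 < p.real {x} := ENNReal.toReal_pos hjump (measure_ne_top _ _)
  have hnx : n.real {x} = 0 := by simp [Measure.real, hneg]
  have hpx' : p'.real {x} = 0 := by simp [Measure.real, hfx'.1]
  have hnx' : n'.real {x} = 0 := by simp [Measure.real, hfx'.2]
  have hmeas : ∀ s : Set ℝ,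
      StronglyMeasurableAtFilter (fun t => f t - u t) (𝓝[s] x) volume := fun s =>
    ⟨Ioo a b, mem_nhdsWithin_of_mem_nhds hnhds, (hf.1.sub hu.1.1).aestronglyMeasurable⟩
  have hr := nonneg_of_hasDerivWithinAt_Ici
    (hαx.hasDerivAt.hasDerivWithinAt.add
      (intervalIntegral.integral_hasDerivWithinAt_of_tendsto_ae_right
        (s := Ici x) (t := Ioi x) (a := x) IntervalIntegrable.refl (hmeas _) (fr.sub ur))) (by
      filter_upwards [mem_nhdsWithin_of_mem_nhds hnhds] with y hy
      simpa using hF y hy)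
  have hl := nonpos_of_hasDerivWithinAt_Iic
    (hαx.hasDerivAt.hasDerivWithinAt.add
      (intervalIntegral.integral_hasDerivWithinAt_of_tendsto_ae_right
        (s := Iic x) (t := Iic x) (a := x) IntervalIntegrable.refl (hmeas _) (fl.sub ul))) (by
      filter_upwards [mem_nhdsWithin_of_mem_nhds hnhds] with y hy
      simpa using hF y hy)
  -- Subtracting `hl` from `hr` cancels `α' x` and the equal one-sided limits of `f`, leaving `p {x}
  -- ≤ 0`.
  linarith

/-- Negation exchanges the Jordan parts of `Du` and preserves the problem, so the positive-atom
result for `-u` and `-f` rules out negative atoms of `Du`. -/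
theorem IsSolution.notMem_jumpSet {a b x : ℝ} (hab : a < b) {f α u : ℝ → ℝ}
    (hf : IsBV a b f) (hα : ContinuousOn α (Icc a b)) (hα0 : ∀ t ∈ Icc a b, 0 ≤ α t)
    (hu : IsSolution a b α f u) (hx : x ∈ Ioo a b) (hαx : DifferentiableAt ℝ α x)
    (hfx : x ∉ jumpSet a b f) : x ∉ jumpSet a b u := by
  have hpos := hu.posPart_singleton_eq_zero hab hf hα hα0 hx hαx hfx
  have hneg := hu.neg.posPart_singleton_eq_zero hab hf.neg hα hα0 hx hαx
    (by rwa [hf.jumpSet_neg])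
  rw [hu.1.distribDeriv_neg, SignedMeasure.toJordanDecomposition_neg,
    JordanDecomposition.neg_posPart] at hneg
  intro h
  refine h.2 ?_
  rw [derivVariation, SignedMeasure.totalVariation, Measure.coe_add, Pi.add_apply, hpos, hneg,
    add_zero]

end WeightedTV

theorem proposition3p3 (a b : ℝ) (hab : a < b) (f α u : ℝ → ℝ)
    (hf : WeightedTV.IsBV a b f)
    (hα : ContinuousOn α (Icc a b)) (hαpos : ∀ t ∈ Icc a b, 0 < α t)
    (hu : WeightedTV.IsSolution a b α f u) :
    (∀ x ∈ Ioo a b, DifferentiableAt ℝ α x →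
      x ∉ WeightedTV.jumpSet a b f → x ∉ WeightedTV.jumpSet a b u) ∧
    WeightedTV.jumpSet a b u \ WeightedTV.jumpSet a b f ⊆
      {x | x ∈ Ioo a b ∧ ¬ DifferentiableAt ℝ α x} := by
  have h : ∀ x ∈ Ioo a b, DifferentiableAt ℝ α x →
      x ∉ WeightedTV.jumpSet a b f → x ∉ WeightedTV.jumpSet a b u := fun x hx hd hfx =>
    hu.notMem_jumpSet hab hf hα (fun t ht => (hαpos t ht).le) hx hd hfx
  exact ⟨h, fun x hx => ⟨hx.1.1, fun hd => h x hx.1.1 hd hx.2 hx.1⟩⟩
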